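/- A unit disk graph is a finite graph whose vertices can be identified with distinct points of the Euclidean plane $\mathbb R^2$ such that two distinct vertices are adjacent if and only if their distance is at most $1$. For a graph $G$ let $\alpha(G)$ be the largest size of a stable set, $\omega(G)$ the largest size of a clique, and $\chi(G)$ the chromatic number. For $n,k\ge 1$ let $C_n^k$ be the graph on $\{0,\dots,n-1\}$ in which distinct $i,j$ are adjacent if and only if their cyclic distance $\min(|i-j|,\,n-|i-j|)$ is at most $k-1$. (i) Every unit disk graph $G$ with $\alpha(G)\le 2$ satisfies $\chi(G)\le \frac32\,\omega(G)$. (ii) For every integer $k\ge 1$ the graph $C_{3k-1}^k$ is a unit disk graph with $\alpha(C_{3k-1}^k)=2$, $\omega(C_{3k-1}^k)=k$ and $$\chi(C_{3k-1}^k)\ \ge\ \tfrac{3k-1}{2}\ =\ \tfrac32\,\omega(C_{3k-1}^k)-\tfrac12 .$$ In particular the factor $\frac32$ in (i) cannot be replaced by a smaller constant: for every real $c<\frac32$ there is a $k\ge 1$ with $\chi(C_{3k-1}^k)>c\,\omega(C_{3k-1}^k)$. -/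

import Mathlib

/-- A graph `G` is a unit disk graph (in the distance model) if its vertices can be identified
with pairwise distinct points of the Euclidean plane so that two distinct vertices are adjacent
exactly when the distance of the corresponding points is at most `1`. -/
def IsUnitDiskGraph {V : Type*} (G : SimpleGraph V) : Prop :=
  ∃ p : V → EuclideanSpace ℝ (Fin 2), Function.Injective p ∧
    ∀ u v : V, G.Adj u v ↔ u ≠ v ∧ dist (p u) (p v) ≤ 1

/-- The circular graph `C_n^k` on the vertices `0, …, n - 1`: distinct `i` and `j` are adjacent
exactly when their distance along the cycle of length `n`, which is
`min |i - j| (n - |i - j|)`, is at most `k - 1` (computed in `ℤ`). -/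
def circularGraph (n k : ℕ) : SimpleGraph (Fin n) where
  Adj i j := i ≠ j ∧
    min |((i : ℕ) : ℤ) - ((j : ℕ) : ℤ)| ((n : ℤ) - |((i : ℕ) : ℤ) - ((j : ℕ) : ℤ)|) ≤ (k : ℤ) - 1
  symm := ⟨by
    rintro i j ⟨h, h'⟩
    refine ⟨h.symm, ?_⟩
    rwa [abs_sub_comm ((j : ℕ) : ℤ) ((i : ℕ) : ℤ)]⟩
  loopless := ⟨fun _ h => h.1 rfl⟩

/-! For (i), the geometry enters only through one claim: every nonempty vertex set `W` contains a
clique `K` with `|W| + 1 ≤ 3 |K|` (`exists_clique_card_add_one_le`). Since `α ≤ 2`, the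
non-neighbours of any vertex form a clique. It thus suffices to cover `W` by cliques, three in all,
with one vertex counted twice. If two points are at distance at least `√3`, the lens of their common
neighbours has diameter at most `1`. Otherwise Helly's theorem puts `W` in a unit disc with some
centre `o`; for `v` farthest from `o`, the line through `o` and `v` splits the neighbours of `v`
into two cliques.

The rest is combinatorial. A matching in the complement gives colour classes of size two. Set `c =
⌊3ω/2⌋` and add universal vertices to the complement to reach `2c` vertices; a perfect matching then
gives a `c`-colouring. Against a Tutte violator, the cliques obtained in the components of the
complement are completely joined in `G`, so their union is a clique, and it is too large.

For (ii), `C_n^k` is realised by a regular `n`-gon, and `n ≤ α χ` gives the lower bound. -/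

lemma exists_clique_of_three_cliques {V : Type*} {G : SimpleGraph V} {W A B C : Finset V}
    (hA : A ⊆ W ∧ G.IsClique A) (hB : B ⊆ W ∧ G.IsClique B) (hC : C ⊆ W ∧ G.IsClique C)
    (h : W.card + 1 ≤ A.card + B.card + C.card) :
    ∃ K ⊆ W, G.IsClique (K : Set V) ∧ W.card + 1 ≤ 3 * K.card := by
  by_cases h1 : W.card + 1 ≤ 3 * A.card
  · exact ⟨A, hA.1, hA.2, h1⟩
  by_cases h2 : W.card + 1 ≤ 3 * B.card
  · exact ⟨B, hB.1, hB.2, h2⟩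
  exact ⟨C, hC.1, hC.2, by omega⟩

/-! ### Plane geometry: large cliques when the stability number is at most two -/

/-- Two points of the unit disc about the origin that lie in the disc of radius `‖o‖ ≤ 1` about `o`,
on the same side of the line through `0` and `o`, have distance at most one. This is the case where
the second point is at least as close in direction to `o` as the first one. -/
lemma sq_dist_le_one_of_half_lens_of_cross_nonneg {p₁ p₂ q₁ q₂ o₁ o₂ : ℝ}
    (ho : o₁ ^ 2 + o₂ ^ 2 ≤ 1) (hp : p₁ ^ 2 + p₂ ^ 2 ≤ 1) (hq : q₁ ^ 2 + q₂ ^ 2 ≤ 1)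
    (hpo : p₁ ^ 2 + p₂ ^ 2 ≤ 2 * (p₁ * o₁ + p₂ * o₂))
    (hqo : q₁ ^ 2 + q₂ ^ 2 ≤ 2 * (q₁ * o₁ + q₂ * o₂))
    (hp' : 0 ≤ p₁ * o₂ - p₂ * o₁) (hq' : 0 ≤ q₁ * o₂ - q₂ * o₁)
    (hqp : 0 ≤ q₁ * p₂ - q₂ * p₁) :
    (p₁ - q₁) ^ 2 + (p₂ - q₂) ^ 2 ≤ 1 := by
  obtain ⟨t, ht0, ht⟩ : ∃ t : ℝ, 0 ≤ t ∧ t ^ 2 = p₁ ^ 2 + p₂ ^ 2 :=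
    ⟨√(p₁ ^ 2 + p₂ ^ 2), Real.sqrt_nonneg _, Real.sq_sqrt (by positivity)⟩
  obtain ⟨r, hr0, hr⟩ : ∃ r : ℝ, 0 ≤ r ∧ r ^ 2 = q₁ ^ 2 + q₂ ^ 2 :=
    ⟨√(q₁ ^ 2 + q₂ ^ 2), Real.sqrt_nonneg _, Real.sq_sqrt (by positivity)⟩
  have ht1 : t ≤ 1 := by nlinarith
  have hr1 : r ≤ 1 := by nlinarith
  -- This suffices because `t² + r² - t r² = t² + r² (1 - t) ≤ t² + 1 - t ≤ 1`.
  suffices key : t * r ^ 2 ≤ 2 * (p₁ * q₁ + p₂ * q₂) by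
    nlinarith [mul_nonneg (sub_nonneg.2 ht1) (sub_nonneg.2 hr1), mul_nonneg ht0 (sub_nonneg.2 ht1),
      mul_nonneg (sub_nonneg.2 ht1) (sub_nonneg.2 (hr.trans_le hq))]
  set d := q₁ * o₂ - q₂ * o₁ with hd
  set s := p₁ * o₂ - p₂ * o₁ with hs
  set e := q₁ * p₂ - q₂ * p₁ with he
  -- Cramer's rule: `d p = s q + e o` with nonnegative coefficients, so for `d > 0` the point `p`
  -- lies in the cone spanned by `q` and `o`. The triangle inequality bounds `d t`, and pairing with
  -- `q` bounds `d (p · q)` from below.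
  have hx : d * p₁ = s * q₁ + e * o₁ := by rw [hd, hs, he]; ring
  have hy : d * p₂ = s * q₂ + e * o₂ := by rw [hd, hs, he]; ring
  rcases hq'.lt_or_eq with hpos | hzero
  · have hqo1 : q₁ * o₁ + q₂ * o₂ ≤ r := by
      refine abs_le_of_sq_le_sq' ?_ hr0 |>.2
      nlinarith [sq_nonneg (q₁ * o₂ - q₂ * o₁)]
    have h1 : d * t ≤ s * r + e := by
      refine abs_le_of_sq_le_sq' ?_ (by positivity) |>.2
      have : (d * t) ^ 2 = s ^ 2 * r ^ 2 + 2 * (s * e) * (q₁ * o₁ + q₂ * o₂)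
          + e ^ 2 * (o₁ ^ 2 + o₂ ^ 2) := by
        rw [mul_pow, ht, hr]
        calc d ^ 2 * (p₁ ^ 2 + p₂ ^ 2) = (d * p₁) ^ 2 + (d * p₂) ^ 2 := by ring
          _ = _ := by rw [hx, hy]; ring
      rw [this]
      nlinarith [mul_le_mul_of_nonneg_left hqo1 (mul_nonneg hp' hqp),
        mul_le_mul_of_nonneg_left ho (sq_nonneg e)]
    have h2 : d * (2 * (p₁ * q₁ + p₂ * q₂)) =
        2 * s * r ^ 2 + 2 * e * (q₁ * o₁ + q₂ * o₂) := by
      rw [hr]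
      calc _ = 2 * ((d * p₁) * q₁ + (d * p₂) * q₂) := by ring
        _ = _ := by rw [hx, hy]; ring
    refine le_of_mul_le_mul_left ?_ hpos
    rw [h2]
    have h3 := mul_le_mul_of_nonneg_right h1 (sq_nonneg r)
    have h4 := mul_le_mul_of_nonneg_left hqo hqp
    have h5 : s * r ^ 2 * r ≤ s * r ^ 2 * 1 := mul_le_mul_of_nonneg_left hr1 (by positivity)
    have h6 : 0 ≤ s * r ^ 2 := by positivity
    rw [← hr] at h4
    nlinarith
  -- Degenerate cone `d = 0`: either `q = 0`, or `p`, `q` and `o` are collinear with the origin and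
  -- `p · q = t r`.
  · rcases hr0.lt_or_eq with hrpos | hr00
    · have hqo0 : 0 < q₁ * o₁ + q₂ * o₂ := by linarith [pow_pos hrpos 2]
      have hpo0 : 0 ≤ p₁ * o₁ + p₂ * o₂ := by linarith [sq_nonneg t]
      have hq1 : q₁ * o₂ = q₂ * o₁ := by linarith
      have hoo : 0 < o₁ ^ 2 + o₂ ^ 2 := by
        by_contra hcon
        have h1 : o₁ = 0 := pow_eq_zero_iff two_ne_zero |>.1
          (by linarith [sq_nonneg o₁, sq_nonneg o₂])
        have h2 : o₂ = 0 := pow_eq_zero_iff two_ne_zero |>.1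
          (by linarith [sq_nonneg o₁, sq_nonneg o₂])
        simp [h1, h2] at hqo0
      have h0 : s * (q₁ * o₁ + q₂ * o₂) + e * (o₁ ^ 2 + o₂ ^ 2) = 0 := by
        have := congrArg₂ (fun a b => a * o₁ + b * o₂) hx hy
        simp only [← hzero] at this
        linarith
      have he0 : e = 0 := by
        have h1 := mul_nonneg hp' hqo0.le
        have h2 := mul_nonneg hqp hoo.le
        exact (mul_eq_zero.1 (by linarith : e * (o₁ ^ 2 + o₂ ^ 2) = 0)).resolve_right hoo.ne'
      have hpq : 0 ≤ p₁ * q₁ + p₂ * q₂ := by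
        have : (p₁ * q₁ + p₂ * q₂) * (o₁ ^ 2 + o₂ ^ 2) =
            (p₁ * o₁ + p₂ * o₂) * (q₁ * o₁ + q₂ * o₂) + s * d := by rw [hs, hd]; ring
        rw [← hzero, mul_zero, add_zero] at this
        exact nonneg_of_mul_nonneg_left (this ▸ mul_nonneg hpo0 hqo0.le) hoo
      have h1 : t * r ≤ p₁ * q₁ + p₂ * q₂ := by
        refine abs_le_of_sq_le_sq' (le_of_eq ?_) hpq |>.2
        have : e ^ 2 = 0 := by rw [he0]; ring
        rw [mul_pow, ht, hr]
        rw [he] at this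
        linarith
      linarith [mul_nonneg (mul_nonneg ht0 hr0) (sub_nonneg.2 hr1)]
    · have h0 : q₁ ^ 2 + q₂ ^ 2 = 0 := by rw [← hr, ← hr00]; ring
      have h1 : q₁ = 0 := pow_eq_zero_iff two_ne_zero |>.1
          (by linarith [sq_nonneg q₁, sq_nonneg q₂])
      have h2 : q₂ = 0 := pow_eq_zero_iff two_ne_zero |>.1
          (by linarith [sq_nonneg q₁, sq_nonneg q₂])
      simp [h1, h2, ← hr00]

lemma sq_dist_le_one_of_half_lens {p₁ p₂ q₁ q₂ o₁ o₂ : ℝ}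
    (ho : o₁ ^ 2 + o₂ ^ 2 ≤ 1) (hp : p₁ ^ 2 + p₂ ^ 2 ≤ 1) (hq : q₁ ^ 2 + q₂ ^ 2 ≤ 1)
    (hpo : p₁ ^ 2 + p₂ ^ 2 ≤ 2 * (p₁ * o₁ + p₂ * o₂))
    (hqo : q₁ ^ 2 + q₂ ^ 2 ≤ 2 * (q₁ * o₁ + q₂ * o₂))
    (hp' : 0 ≤ p₁ * o₂ - p₂ * o₁) (hq' : 0 ≤ q₁ * o₂ - q₂ * o₁) :
    (p₁ - q₁) ^ 2 + (p₂ - q₂) ^ 2 ≤ 1 := by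
  rcases le_total 0 (q₁ * p₂ - q₂ * p₁) with h | h
  · exact sq_dist_le_one_of_half_lens_of_cross_nonneg ho hp hq hpo hqo hp' hq' h
  · have := sq_dist_le_one_of_half_lens_of_cross_nonneg ho hq hp hqo hpo hq' hp' (by linarith)
    linarith

lemma dist_le_one_iff_sq (x y : EuclideanSpace ℝ (Fin 2)) :
    dist x y ≤ 1 ↔ (x 0 - y 0) ^ 2 + (x 1 - y 1) ^ 2 ≤ 1 := by
  rw [EuclideanSpace.dist_eq, Real.sqrt_le_iff, one_pow, and_iff_right zero_le_one, Fin.sum_univ_two,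
    Real.dist_eq, Real.dist_eq, sq_abs, sq_abs]

/-- A triangle with one side at most `1` and all sides at most `√3` lies in a unit disc. -/
lemma exists_unit_disc_of_triangle {x y z : EuclideanSpace ℝ (Fin 2)}
    (hxy : (x 0 - y 0) ^ 2 + (x 1 - y 1) ^ 2 ≤ 1)
    (hxz : (x 0 - z 0) ^ 2 + (x 1 - z 1) ^ 2 ≤ 3)
    (hyz : (y 0 - z 0) ^ 2 + (y 1 - z 1) ^ 2 ≤ 3) :
    ∃ o : EuclideanSpace ℝ (Fin 2), dist o x ≤ 1 ∧ dist o y ≤ 1 ∧ dist o z ≤ 1 := by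
  simp only [dist_le_one_iff_sq]
  by_cases hb : 2 ≤ (x 0 - z 0) ^ 2 + (x 1 - z 1) ^ 2 ∧ 2 ≤ (y 0 - z 0) ^ 2 + (y 1 - z 1) ^ 2
  · obtain ⟨h1, h2⟩ := hb
    -- A point on the median from `z`. Its squared distance to `x` is about `0.204 |xy|² + 0.307
    -- |xz|² - 0.123 |yz|²`, so the lower bound `2` on `|yz|²` is needed; symmetrically for `y`.
    refine ⟨!₂[0.285 * (x 0 + y 0) + 0.43 * z 0, 0.285 * (x 1 + y 1) + 0.43 * z 1], ?_, ?_, ?_⟩ <;>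
      simp only [Matrix.cons_val_zero, Matrix.cons_val_one] <;>
      ring_nf at hxy hxz hyz h1 h2 ⊢ <;> linarith [sq_nonneg (x 0 - y 0), sq_nonneg (x 1 - y 1)]
  · rcases le_total ((x 0 - z 0) ^ 2 + (x 1 - z 1) ^ 2) ((y 0 - z 0) ^ 2 + (y 1 - z 1) ^ 2)
      with h | h
    · have h2 : (x 0 - z 0) ^ 2 + (x 1 - z 1) ^ 2 ≤ 2 := by
        by_contra hc
        exact hb ⟨by linarith, by linarith⟩
      -- The midpoint of the longer side at `z`: by the median formula its squared distance to `x`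
      -- is at most `1/2 + |xz|²/4 ≤ 1`.
      refine ⟨!₂[(y 0 + z 0) / 2, (y 1 + z 1) / 2], ?_, ?_, ?_⟩ <;>
      simp only [Matrix.cons_val_zero, Matrix.cons_val_one] <;> nlinarith
    · have h2 : (y 0 - z 0) ^ 2 + (y 1 - z 1) ^ 2 ≤ 2 := by
        by_contra hc
        exact hb ⟨by linarith, by linarith⟩
      refine ⟨!₂[(x 0 + z 0) / 2, (x 1 + z 1) / 2], ?_, ?_, ?_⟩ <;>
      simp only [Matrix.cons_val_zero, Matrix.cons_val_one] <;> nlinarith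

/-- Helly's theorem for unit discs about finitely many points of the plane. -/
lemma exists_unit_disc_of_triples {V : Type*} (p : V → EuclideanSpace ℝ (Fin 2)) (W : Finset V)
    (h : ∀ a ∈ W, ∀ b ∈ W, ∀ c ∈ W, ∃ o, dist o (p a) ≤ 1 ∧ dist o (p b) ≤ 1 ∧ dist o (p c) ≤ 1) :
    ∃ o, ∀ a ∈ W, dist o (p a) ≤ 1 := by
  classical
  have := Convex.helly_theorem' (𝕜 := ℝ) (F := fun a => Metric.closedBall (p a) 1) (s := W)
    (fun i _ => convex_closedBall _ _) (by
      intro I hI hcard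
      rw [finrank_euclideanSpace_fin] at hcard
      have hc : I.card = 0 ∨ I.card = 1 ∨ I.card = 2 ∨ I.card = 3 := by omega
      rcases hc with hc | hc | hc | hc
      · rw [Finset.card_eq_zero] at hc
        simp [hc]
      · obtain ⟨a, rfl⟩ := Finset.card_eq_one.1 hc
        exact ⟨p a, by simp⟩
      · obtain ⟨a, b, -, rfl⟩ := Finset.card_eq_two.1 hc
        obtain ⟨o, h1, h2, -⟩ := h a (hI (by simp)) b (hI (by simp)) b (hI (by simp))
        exact ⟨o, by simp [h1, h2]⟩
      · obtain ⟨a, b, c, -, -, -, rfl⟩ := Finset.card_eq_three.1 hc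
        obtain ⟨o, h1, h2, h3⟩ := h a (hI (by simp)) b (hI (by simp)) c (hI (by simp))
        exact ⟨o, by simp [h1, h2, h3]⟩)
  obtain ⟨o, ho⟩ := this
  exact ⟨o, fun a ha => by simpa using Set.mem_iInter₂.1 ho a ha⟩

/-- A nonempty finite set `W` of vertices of a unit disk graph of stability number at most two
contains a clique `K` with `|W| + 1 ≤ 3 |K|`. -/
lemma exists_clique_card_add_one_le {V : Type*} {G : SimpleGraph V}
    {p : V → EuclideanSpace ℝ (Fin 2)}
    (hG : ∀ u v : V, G.Adj u v ↔ u ≠ v ∧ dist (p u) (p v) ≤ 1)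
    (hα : ∀ a b c : V, a ≠ b → a ≠ c → b ≠ c → G.Adj a b ∨ G.Adj a c ∨ G.Adj b c)
    {W : Finset V} (hW : W.Nonempty) :
    ∃ K ⊆ W, G.IsClique (K : Set V) ∧ W.card + 1 ≤ 3 * K.card := by
  classical
  have hfar : ∀ u, G.IsClique ((W.filter fun a => ¬ dist (p a) (p u) ≤ 1 : Finset V) : Set V) := by
    intro u a ha b hb hab
    simp only [Finset.coe_filter, Set.mem_ofPred_eq] at ha hb
    have hau : a ≠ u := by rintro rfl; simp at ha
    have hbu : b ≠ u := by rintro rfl; simp at hb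
    rcases hα a b u hab hau hbu with h | h | h
    · exact h
    · exact absurd ((hG _ _).1 h).2 ha.2
    · exact absurd ((hG _ _).1 h).2 hb.2
  by_cases hlong : ∃ u ∈ W, ∃ w ∈ W, 3 ≤ (p u 0 - p w 0) ^ 2 + (p u 1 - p w 1) ^ 2
  · obtain ⟨u, hu, w, hw, huw⟩ := hlong
    set L := W.filter fun a => dist (p a) (p u) ≤ 1 ∧ dist (p a) (p w) ≤ 1 with hL
    have huL : u ∉ L := by
      simp only [hL, Finset.mem_filter, dist_le_one_iff_sq]
      rintro ⟨-, -, h⟩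
      linarith
    have hclique : G.IsClique ((insert u L : Finset V) : Set V) := by
      rw [Finset.coe_insert, SimpleGraph.isClique_insert]
      constructor
      · intro a ha b hb hab
        simp only [hL, Finset.coe_filter, Set.mem_ofPred_eq, dist_le_one_iff_sq] at ha hb
        rw [hG, dist_le_one_iff_sq]
        refine ⟨hab, ?_⟩
        -- Parallelogram law: a common neighbour is within `1/2` of the midpoint of `p u` and `p w`,
        -- since `2 + 2 - 3 = 1`.
        have key (c : EuclideanSpace ℝ (Fin 2)) (h1 : (c 0 - p u 0) ^ 2 + (c 1 - p u 1) ^ 2 ≤ 1)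
            (h2 : (c 0 - p w 0) ^ 2 + (c 1 - p w 1) ^ 2 ≤ 1) :
            (2 * c 0 - (p u 0 + p w 0)) ^ 2 + (2 * c 1 - (p u 1 + p w 1)) ^ 2 ≤ 1 := by
          linarith
        have h1 := key _ ha.2.1 ha.2.2
        have h2 := key _ hb.2.1 hb.2.2
        linarith [sq_nonneg ((2 * p a 0 - (p u 0 + p w 0)) + (2 * p b 0 - (p u 0 + p w 0))),
          sq_nonneg ((2 * p a 1 - (p u 1 + p w 1)) + (2 * p b 1 - (p u 1 + p w 1)))]
      · intro b hb hub
        rw [Finset.mem_coe, hL, Finset.mem_filter] at hb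
        exact (hG _ _).2 ⟨hub, by rw [dist_comm]; exact hb.2.1⟩
    refine exists_clique_of_three_cliques ⟨Finset.filter_subset _ _, hfar u⟩
      ⟨Finset.filter_subset _ _, hfar w⟩
      ⟨Finset.insert_subset hu (Finset.filter_subset _ _), hclique⟩ ?_
    -- The extra `1` is `u`, which also lies among the non-neighbours of `w`.
    rw [Finset.card_insert_of_notMem huL, ← add_assoc]
    gcongr
    refine (Finset.card_le_card ?_).trans ((Finset.card_union_le _ _).trans
      (Nat.add_le_add_right (Finset.card_union_le _ _) _))
    intro a ha
    simp only [hL, Finset.mem_union, Finset.mem_filter]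
    tauto
  · push Not at hlong
    obtain ⟨o, ho⟩ := exists_unit_disc_of_triples p W (by
      intro a ha b hb c hc
      have hab := (hlong a ha b hb).le
      have hac := (hlong a ha c hc).le
      have hbc := (hlong b hb c hc).le
      have hba := (hlong b hb a ha).le
      have hcb := (hlong c hc b hb).le
      have hca := (hlong c hc a ha).le
      have : dist (p a) (p b) ≤ 1 ∨ dist (p a) (p c) ≤ 1 ∨ dist (p b) (p c) ≤ 1 := by
        by_cases h1 : a = b
        · simp [h1]
        by_cases h2 : a = c
        · simp [h2]
        by_cases h3 : b = c
        · simp [h3]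
        exact (hα a b c h1 h2 h3).imp (fun h => ((hG _ _).1 h).2)
          (Or.imp (fun h => ((hG _ _).1 h).2) (fun h => ((hG _ _).1 h).2))
      simp only [dist_le_one_iff_sq (p _) (p _)] at this
      rcases this with h | h | h
      · exact exists_unit_disc_of_triangle h hac hbc
      · obtain ⟨o, h1, h2, h3⟩ := exists_unit_disc_of_triangle h hab hcb
        exact ⟨o, h1, h3, h2⟩
      · obtain ⟨o, h1, h2, h3⟩ := exists_unit_disc_of_triangle h hba hca
        exact ⟨o, h3, h1, h2⟩)
    obtain ⟨v, hv, hmax⟩ := W.exists_max_image (fun a => dist o (p a)) hW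
    have hov := (dist_le_one_iff_sq _ _).1 (ho v hv)
    have hdisc : ∀ a ∈ W, (o 0 - p a 0) ^ 2 + (o 1 - p a 1) ^ 2 ≤
        (o 0 - p v 0) ^ 2 + (o 1 - p v 1) ^ 2 := by
      intro a ha
      have := hmax a ha
      simp only [EuclideanSpace.dist_eq, Fin.sum_univ_two, Real.dist_eq, sq_abs] at this
      exact (Real.sqrt_le_sqrt_iff (by positivity)).1 this
    let cr (a : V) : ℝ := (p a 0 - p v 0) * (o 1 - p v 1) - (p a 1 - p v 1) * (o 0 - p v 0)
    have hvv : cr v = 0 := by simp [cr]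
    set B := W.filter fun a => dist (p a) (p v) ≤ 1 ∧ 0 ≤ cr a with hB
    set C := W.filter fun a => dist (p a) (p v) ≤ 1 ∧ cr a ≤ 0 with hC
    refine exists_clique_of_three_cliques (A := W.filter fun a => ¬ dist (p a) (p v) ≤ 1)
      (B := B) (C := C) ⟨Finset.filter_subset _ _, hfar v⟩
      ⟨Finset.filter_subset _ _, ?_⟩ ⟨Finset.filter_subset _ _, ?_⟩ ?_
    · intro a ha b hb hab
      simp only [hB, Finset.coe_filter, Set.mem_ofPred_eq, dist_le_one_iff_sq, cr] at ha hb
      refine (hG _ _).2 ⟨hab, (dist_le_one_iff_sq _ _).2 ?_⟩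
      have := sq_dist_le_one_of_half_lens (p₁ := p a 0 - p v 0) (p₂ := p a 1 - p v 1)
        (q₁ := p b 0 - p v 0) (q₂ := p b 1 - p v 1) (o₁ := o 0 - p v 0) (o₂ := o 1 - p v 1)
        hov ha.2.1 hb.2.1 (by linarith [hdisc a ha.1]) (by linarith [hdisc b hb.1]) ha.2.2 hb.2.2
      linarith
    · intro a ha b hb hab
      simp only [hC, Finset.coe_filter, Set.mem_ofPred_eq, dist_le_one_iff_sq, cr] at ha hb
      refine (hG _ _).2 ⟨hab, (dist_le_one_iff_sq _ _).2 ?_⟩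
      -- Swapping the coordinates reflects the plane and reverses the sign of `cr`.
      have := sq_dist_le_one_of_half_lens (p₂ := p a 0 - p v 0) (p₁ := p a 1 - p v 1)
        (q₂ := p b 0 - p v 0) (q₁ := p b 1 - p v 1) (o₂ := o 0 - p v 0) (o₁ := o 1 - p v 1)
        (by linarith) (by linarith) (by linarith) (by linarith [hdisc a ha.1])
        (by linarith [hdisc b hb.1]) (by linarith) (by linarith)
      linarith
    -- The extra `1` is `v`, which lies on the dividing line.
    · have h1 : 1 ≤ (B ∩ C).card := Finset.card_pos.2 ⟨v, by simp [hB, hC, hv, hvv]⟩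
      have h2 := Finset.card_union_add_card_inter B C
      have h3 : W.card ≤ (W.filter fun a => ¬ dist (p a) (p v) ≤ 1).card + (B ∪ C).card := by
        refine (Finset.card_le_card ?_).trans (Finset.card_union_le _ _)
        intro a ha
        have := le_total 0 (cr a)
        simp only [hB, hC, Finset.mem_union, Finset.mem_filter]
        tauto
      omega

/-! ### From large cliques to colourings: matchings in the complement -/

/-- If every nonempty vertex set `W` contains a clique `K` with `|W| + 1 ≤ 3 |K|`, and `X` is a graph
on some vertices of `G` such that vertices not adjacent in `X` are adjacent in `G`, then the
cliques found in the components of `X` combine to one clique. -/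
lemma card_add_card_connectedComponent_le {V U : Type*} [Finite V] [Finite U] {G : SimpleGraph V}
    (hG : ∀ W : Finset V, W.Nonempty →
      ∃ K ⊆ W, G.IsClique (K : Set V) ∧ W.card + 1 ≤ 3 * K.card)
    (X : SimpleGraph U) (f : U → V) (hf : Function.Injective f)
    (hX : ∀ a b, a ≠ b → ¬ X.Adj a b → G.Adj (f a) (f b)) :
    Nat.card U + Nat.card X.ConnectedComponent ≤ 3 * G.cliqueNum := by
  classical
  have := Fintype.ofFinite U
  have := Fintype.ofFinite X.ConnectedComponent
  let W (C : X.ConnectedComponent) : Finset U :=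
    Finset.univ.filter fun a => X.connectedComponentMk a = C
  have hne (C : X.ConnectedComponent) : ((W C).image f).Nonempty := by
    obtain ⟨a, ha⟩ := C.exists_rep
    exact ⟨f a, Finset.mem_image_of_mem _ (Finset.mem_filter.2 ⟨Finset.mem_univ _, ha⟩)⟩
  choose K hKW hK hcard using fun C => hG _ (hne C)
  have hrep : ∀ C, ∀ v ∈ K C, ∃ a, X.connectedComponentMk a = C ∧ f a = v := by
    intro C v hv
    simpa [W] using hKW C hv
  have hdisj : ∀ C ∈ (Finset.univ : Finset X.ConnectedComponent),
      ∀ D ∈ (Finset.univ : Finset X.ConnectedComponent), C ≠ D → Disjoint (K C) (K D) := by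
    intro C _ D _ hCD
    rw [Finset.disjoint_left]
    intro v hv hv'
    obtain ⟨a, ha, rfl⟩ := hrep C v hv
    obtain ⟨b, hb, hab⟩ := hrep D _ hv'
    rw [hf hab] at hb
    exact hCD (ha.symm.trans hb)
  have hclique : G.IsClique ((Finset.univ.biUnion K : Finset V) : Set V) := by
    intro v hv w hw hvw
    simp only [Finset.coe_biUnion, Set.mem_iUnion, Finset.mem_coe, Finset.mem_univ,
      exists_prop, true_and] at hv hw
    obtain ⟨C, hC⟩ := hv
    obtain ⟨D, hD⟩ := hw
    by_cases hCD : C = D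
    · subst hCD
      exact hK C hC hD hvw
    · obtain ⟨a, ha, rfl⟩ := hrep C v hC
      obtain ⟨b, hb, rfl⟩ := hrep D w hD
      refine hX a b (fun h => hvw (h ▸ rfl)) fun hadj => hCD ?_
      rw [← ha, ← hb]
      exact SimpleGraph.ConnectedComponent.eq.2 hadj.reachable
  have h1 : ∑ C, (K C).card ≤ G.cliqueNum := by
    rw [← Finset.card_biUnion hdisj]
    exact hclique.card_le_cliqueNum
  have h2 : Nat.card U = ∑ C, (W C).card := by
    rw [Nat.card_eq_fintype_card, ← Finset.card_univ]
    exact Finset.card_eq_sum_card_fiberwise (f := X.connectedComponentMk) (by simp)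
  have h3 : ∑ C, ((W C).card + 1) ≤ ∑ C, 3 * (K C).card :=
    Finset.sum_le_sum fun C _ => by simpa [Finset.card_image_of_injective _ hf] using hcard C
  rw [Finset.sum_add_distrib, ← Finset.mul_sum, Finset.sum_const, smul_eq_mul, mul_one,
    Finset.card_univ, ← Nat.card_eq_fintype_card] at h3
  omega

/-- If `f` embeds the vertices of `G` into a graph `H` on `2 c` vertices whose edges between images
come from non-edges of `G`, then a perfect matching of `H` gives a colouring of `G` with `c`
colours. -/
lemma colorable_of_isPerfectMatching {V U : Type*} [Finite U] {G : SimpleGraph V}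
    {H : SimpleGraph U} {f : V → U} (hf : Function.Injective f)
    (hH : ∀ u v, H.Adj (f u) (f v) → ¬ G.Adj u v) {M : H.Subgraph} (hM : M.IsPerfectMatching)
    {c : ℕ} (hc : Nat.card U = 2 * c) : G.Colorable c := by
  classical
  have := Fintype.ofFinite U
  have hM' := SimpleGraph.Subgraph.isPerfectMatching_iff.1 hM
  choose g hg hg' using hM'
  let N := M.spanningCoe
  have hdeg : ∀ v, N.degree v = 1 := by
    intro v
    rw [← SimpleGraph.card_neighborFinset_eq_degree, Finset.card_eq_one]
    refine ⟨g v, ?_⟩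
    ext w
    simp only [SimpleGraph.mem_neighborFinset, Finset.mem_singleton]
    exact ⟨fun h => hg' v w h, fun h => h ▸ hg v⟩
  have hcard : Fintype.card N.edgeSet = c := by
    have := N.sum_degrees_eq_twice_card_edges
    simp only [hdeg, Finset.sum_const, Finset.card_univ, smul_eq_mul, mul_one] at this
    rw [← Nat.card_eq_fintype_card, hc] at this
    rw [← SimpleGraph.edgeFinset_card]
    omega
  have hcol : G.Coloring N.edgeSet := SimpleGraph.Coloring.mk
    (fun v => ⟨s(f v, g (f v)), hg (f v)⟩) (by
      intro u v huv h
      have h := congrArg Subtype.val h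
      simp only [Sym2.eq_iff] at h
      rcases h with ⟨h, -⟩ | ⟨h, -⟩
      · exact huv.ne (hf h)
      · refine hH v u ?_ huv.symm
        rw [h]
        exact (M.adj_sub (hg (f v))))
  rw [← hcard]
  exact hcol.colorable

/-- **Colouring with stability number two.** If every nonempty vertex set `W` contains a clique `K`
with `|W| + 1 ≤ 3 |K|`, then `⌊3 ω / 2⌋` colours suffice. -/
lemma colorable_three_mul_cliqueNum_div_two {V : Type*} [Finite V] {G : SimpleGraph V}
    (hG : ∀ W : Finset V, W.Nonempty →
      ∃ K ⊆ W, G.IsClique (K : Set V) ∧ W.card + 1 ≤ 3 * K.card) :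
    G.Colorable (3 * G.cliqueNum / 2) := by
  classical
  have := Fintype.ofFinite V
  rcases isEmpty_or_nonempty V with hV | hV
  · exact SimpleGraph.Colorable.of_isEmpty _
  have hn : Nat.card V + 1 ≤ 3 * G.cliqueNum := by
    obtain ⟨K, -, hK, h⟩ := hG Finset.univ Finset.univ_nonempty
    have := hK.card_le_cliqueNum
    rw [Finset.card_univ, ← Nat.card_eq_fintype_card] at h
    omega
  set c := 3 * G.cliqueNum / 2 with hc
  obtain ⟨d, hd⟩ : ∃ d, Nat.card V + d = 2 * c := Nat.exists_eq_add_of_le (by omega) |>.imp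
    fun _ h => h.symm
  -- The complement of `G` together with `d` vertices adjacent to everything.
  let H : SimpleGraph (V ⊕ Fin d) := (G.map Function.Embedding.inl)ᶜ
  have hHadj : ∀ u v, H.Adj (Sum.inl u) (Sum.inl v) ↔ u ≠ v ∧ ¬ G.Adj u v := by
    intro u v
    simp [H, SimpleGraph.map_adj]
  have hHr : ∀ i x, Sum.inr i ≠ x → H.Adj (Sum.inr i) x := by
    intro i x hx
    simp [H, SimpleGraph.map_adj, hx]
  have hcardU : Nat.card (V ⊕ Fin d) = 2 * c := by simpa using hd
  obtain ⟨M, hM⟩ : ∃ M : H.Subgraph, M.IsPerfectMatching := by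
    rw [SimpleGraph.tutte]
    intro S hS
    rw [SimpleGraph.IsTutteViolator] at hS
    have hSc : S.ncard + Nat.card ((⊤ : H.Subgraph).deleteVerts S).verts = 2 * c := by
      rw [← hcardU, Nat.card_coe_set_eq, SimpleGraph.Subgraph.deleteVerts_verts,
        SimpleGraph.Subgraph.verts_top, ← Set.compl_eq_univ_sdiff]
      exact Set.ncard_add_ncard_compl S
    have hpar := ((⊤ : H.Subgraph).deleteVerts S).coe.odd_ncard_oddComponents
    have hle : ((⊤ : H.Subgraph).deleteVerts S).coe.oddComponents.ncard ≤
        Nat.card ((⊤ : H.Subgraph).deleteVerts S).coe.ConnectedComponent := Set.ncard_le_card _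
    have hmem : ∀ x : ((⊤ : H.Subgraph).deleteVerts S).verts, x.1 ∉ S := fun x => by
      have := x.2
      simp only [SimpleGraph.Subgraph.deleteVerts_verts, Set.mem_sdiff] at this
      exact this.2
    have hadj : ∀ x y : ((⊤ : H.Subgraph).deleteVerts S).verts, H.Adj x.1 y.1 →
        ((⊤ : H.Subgraph).deleteVerts S).coe.Adj x y := fun x y h => by
      simp [hmem, h]
    -- A surviving universal vertex leaves a connected graph, so a violator would be empty with one
    -- odd component, although `2 * c` is even.
    by_cases hi : ∃ i, Sum.inr i ∉ S
    · obtain ⟨i, hi⟩ := hi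
      let x₀ : ((⊤ : H.Subgraph).deleteVerts S).verts := ⟨Sum.inr i, by simp [hi]⟩
      have hr : ∀ y, ((⊤ : H.Subgraph).deleteVerts S).coe.Reachable x₀ y := fun y => by
        by_cases hy : x₀ = y
        · rw [hy]
        · exact (hadj _ _ (hHr _ _ fun h => hy (Subtype.ext h))).reachable
      have hsub : Subsingleton ((⊤ : H.Subgraph).deleteVerts S).coe.ConnectedComponent := by
        refine SimpleGraph.Preconnected.subsingleton_connectedComponent fun x y => ?_
        exact (hr x).symm.trans (hr y)
      have := Finite.card_le_one_iff_subsingleton.2 hsub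
      rw [show ((⊤ : H.Subgraph).deleteVerts S).coe.oddComponents.ncard = 1 by omega] at hpar
      have := hpar.1 odd_one
      rw [Nat.odd_iff] at this
      omega
    · push Not at hi
      have hl : ∀ x : ((⊤ : H.Subgraph).deleteVerts S).verts, ∃ v, Sum.inl v = x.1 := fun x => by
        rcases hx : x.1 with v | i
        · exact ⟨v, rfl⟩
        · exact absurd (hi i) (hx ▸ hmem x)
      choose f hf using hl
      have := card_add_card_connectedComponent_le hG ((⊤ : H.Subgraph).deleteVerts S).coe f
        (fun x y h => Subtype.ext (by rw [← hf, ← hf, h])) (fun x y hxy hn => by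
          by_contra hG'
          refine hn (hadj _ _ ?_)
          rw [← hf, ← hf, hHadj]
          refine ⟨fun h => hxy (Subtype.ext (by rw [← hf, ← hf, h])), hG'⟩)
      -- By parity the odd components exceed `|S|` by at least two, whence `2c + 2 ≤ 3ω`,
      -- contradicting the choice of `c`.
      rw [Nat.odd_iff, Nat.odd_iff] at hpar
      omega
  exact colorable_of_isPerfectMatching Sum.inl_injective (fun u v h => ((hHadj u v).1 h).2) hM hcardU

lemma adj_of_indepNum_le_two {V : Type*} [Finite V] {G : SimpleGraph V} (h : G.indepNum ≤ 2)
    (a b c : V) (hab : a ≠ b) (hac : a ≠ c) (hbc : b ≠ c) :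
    G.Adj a b ∨ G.Adj a c ∨ G.Adj b c := by
  classical
  by_contra hcon
  push Not at hcon
  obtain ⟨h1, h2, h3⟩ := hcon
  have hind : G.IsIndepSet (({a, b, c} : Finset V) : Set V) := by
    intro x hx y hy hxy
    simp only [Finset.coe_insert, Finset.coe_singleton, Set.mem_insert_iff,
      Set.mem_singleton_iff] at hx hy
    rcases hx with rfl | rfl | rfl <;> rcases hy with rfl | rfl | rfl <;>
      first | exact absurd rfl hxy | assumption | (rw [SimpleGraph.adj_comm]; assumption)
  have := hind.card_le_indepNum
  rw [Finset.card_eq_three.2 ⟨a, b, c, hab, hac, hbc, rfl⟩] at this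
  omega

theorem IsUnitDiskGraph.chromaticNumber_le {V : Type*} [Finite V] {G : SimpleGraph V}
    (hG : IsUnitDiskGraph G) (hα : G.indepNum ≤ 2) :
    ∃ m : ℕ, G.chromaticNumber = (m : ℕ∞) ∧ (m : ℝ) ≤ 3 / 2 * (G.cliqueNum : ℝ) := by
  obtain ⟨p, -, hp⟩ := hG
  have hcol := colorable_three_mul_cliqueNum_div_two fun W hW =>
    exists_clique_card_add_one_le hp (adj_of_indepNum_le_two hα) (W := W) hW
  have hle := hcol.chromaticNumber_le
  lift G.chromaticNumber to ℕ using (hle.trans_lt (ENat.natCast_lt_top _)).ne with m hm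
  refine ⟨m, rfl, ?_⟩
  have : 2 * m ≤ 3 * G.cliqueNum := by
    have := Nat.cast_le.1 hle
    omega
  have : (2 : ℝ) * m ≤ 3 * G.cliqueNum := by exact_mod_cast this
  linarith

/-! ### The circular graphs -/

lemma circularGraph_adj_of_lt {n k : ℕ} {i j : Fin n} (hij : i < j) :
    (circularGraph n k).Adj i j ↔ (j : ℕ) < i + k ∨ n + i < j + k := by
  have h : (i : ℕ) < j := hij
  have hj := j.isLt
  have habs : |((i : ℕ) : ℤ) - ((j : ℕ) : ℤ)| = (j : ℕ) - (i : ℕ) := by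
    rw [abs_of_neg (by omega)]
    ring
  simp only [circularGraph, habs, min_le_iff]
  constructor
  · rintro ⟨-, h⟩
    omega
  · intro h
    exact ⟨hij.ne, by omega⟩

lemma sin_pi_mul_div_mono {n x y : ℝ} (hn : 0 < n) (hx : 0 ≤ x) (hxy : x ≤ y) (hy : 2 * y ≤ n) :
    Real.sin (Real.pi * x / n) ≤ Real.sin (Real.pi * y / n) := by
  have hπ := Real.pi_pos
  apply Real.sin_le_sin_of_le_of_le_pi_div_two
  · have : 0 ≤ Real.pi * x / n := by positivity
    linarith
  · rw [div_le_div_iff₀ hn two_pos]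
    nlinarith
  · gcongr

lemma sin_pi_mul_sub_div {n : ℝ} (hn : n ≠ 0) (x : ℝ) :
    Real.sin (Real.pi * (n - x) / n) = Real.sin (Real.pi * x / n) := by
  rw [← Real.sin_pi_sub]
  congr 1
  field_simp
  ring

lemma dist_polygon (r s t : ℝ) :
    dist (!₂[r * Real.cos (2 * s), r * Real.sin (2 * s)] : EuclideanSpace ℝ (Fin 2))
      !₂[r * Real.cos (2 * t), r * Real.sin (2 * t)] = |2 * r * Real.sin (t - s)| := by
  rw [EuclideanSpace.dist_eq, ← Real.sqrt_sq_eq_abs, Fin.sum_univ_two]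
  congr 1
  simp only [Real.dist_eq, sq_abs, Matrix.cons_val_zero, Matrix.cons_val_one, Real.sin_sub,
    Real.cos_two_mul, Real.sin_two_mul]
  have h1 := Real.sin_sq_add_cos_sq s
  have h2 := Real.sin_sq_add_cos_sq t
  have h3 : Real.sin s ^ 2 = 1 - Real.cos s ^ 2 := by linarith
  have h4 : Real.sin t ^ 2 = 1 - Real.cos t ^ 2 := by linarith
  ring_nf
  rw [h3, h4]
  ring

/-- In a regular `n`-gon the chord length increases with the cyclic distance up to `n / 2`, so a
suitable scaling puts the threshold `1` between the chords of `k - 1` and `k` steps. -/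
lemma isUnitDiskGraph_circularGraph {n k : ℕ} (hk : 1 ≤ k) (hkn : 2 * k ≤ n) :
    IsUnitDiskGraph (circularGraph n k) := by
  have hn : (0 : ℝ) < n := by
    have : 0 < n := by omega
    exact_mod_cast this
  have hπ := Real.pi_pos
  have hkn' : (2 : ℝ) * k ≤ n := by exact_mod_cast hkn
  have hk' : (1 : ℝ) ≤ k := by exact_mod_cast hk
  set g : ℝ → ℝ := fun x => Real.sin (Real.pi * x / n) with hg
  have hgpos : ∀ x : ℝ, 0 < x → x < n → 0 < g x := fun x h0 h1 =>
    Real.sin_pos_of_pos_of_lt_pi (by positivity) (by rw [div_lt_iff₀ hn]; gcongr)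
  have hg0 : 0 ≤ g (k - 1) := by
    rcases hk'.eq_or_lt with h | h
    · simp [hg, ← h]
    · exact (hgpos _ (by linarith) (by linarith)).le
  have hg1 : 0 < g k := hgpos _ (by linarith) (by linarith)
  have hlt : g (k - 1) < g k := by
    apply Real.sin_lt_sin_of_lt_of_le_pi_div_two
    · have : 0 ≤ Real.pi * ((k : ℝ) - 1) / n :=
        div_nonneg (mul_nonneg hπ.le (by linarith)) hn.le
      linarith
    · rw [div_le_div_iff₀ hn two_pos]
      nlinarith
    · gcongr
      linarith
  -- A chord of `d` steps has length `2 * r * g d`; this radius makes the chords of `k - 1` and `k`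
  -- steps average to `1`.
  set r : ℝ := 1 / (g (k - 1) + g k) with hr
  have hr0 : 0 < r := by positivity
  let p (i : Fin n) : EuclideanSpace ℝ (Fin 2) :=
    !₂[r * Real.cos (2 * (Real.pi * (i : ℕ) / n)), r * Real.sin (2 * (Real.pi * (i : ℕ) / n))]
  have hpos : ∀ i j : Fin n, i < j → 0 < g ((j : ℕ) - (i : ℕ)) := by
    intro i j hij
    have h1 : ((i : ℕ) : ℝ) < (j : ℕ) := by exact_mod_cast hij
    have h2 : ((j : ℕ) : ℝ) < n := by exact_mod_cast j.isLt
    have h3 : (0 : ℝ) ≤ (i : ℕ) := by positivity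
    exact hgpos _ (by linarith) (by linarith)
  have hdist : ∀ i j : Fin n, i < j → dist (p i) (p j) = 2 * r * g ((j : ℕ) - (i : ℕ)) := by
    intro i j hij
    have := hpos i j hij
    rw [dist_polygon, ← sub_div, ← mul_sub, abs_of_nonneg (by positivity)]
  have hadj : ∀ i j : Fin n, i < j → ((circularGraph n k).Adj i j ↔ dist (p i) (p j) ≤ 1) := by
    intro i j hij
    have hj := j.isLt
    have hij' : (i : ℕ) < j := hij
    obtain ⟨d, hd⟩ : ∃ d, (i : ℕ) + d = j := ⟨j - i, by omega⟩
    have hd' : ((j : ℕ) : ℝ) - (i : ℕ) = d := by rw [← hd]; push_cast; ring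
    rw [hdist i j hij, circularGraph_adj_of_lt hij, hd', hr, mul_one_div, div_mul_eq_mul_div,
      div_le_one (by positivity)]
    have hsymm : g (n - d) = g d := sin_pi_mul_sub_div hn.ne' _
    constructor
    · rintro (h | h)
      · have h1 : (d : ℝ) ≤ k - 1 := by
          have : d + 1 ≤ k := by omega
          have : (d : ℝ) + 1 ≤ k := by exact_mod_cast this
          linarith
        have : g d ≤ g (k - 1) := sin_pi_mul_div_mono hn (by positivity) h1 (by linarith)
        linarith
      · have h1 : (n : ℝ) - d ≤ k - 1 := by
          have : n + 1 ≤ d + k := by omega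
          have : (n : ℝ) + 1 ≤ d + k := by exact_mod_cast this
          linarith
        have h2 : (d : ℝ) ≤ n := by
          have : d ≤ n := by omega
          exact_mod_cast this
        have : g (n - d) ≤ g (k - 1) :=
          sin_pi_mul_div_mono hn (by linarith) h1 (by linarith)
        linarith
    · intro h
      by_contra hcon
      have h1 : (k : ℝ) ≤ d := by
        have : k ≤ d := by omega
        exact_mod_cast this
      have h2 : (d : ℝ) + k ≤ n := by
        have : d + k ≤ n := by omega
        exact_mod_cast this
      have : g k ≤ g d := by
        rcases le_total (2 * (d : ℝ)) n with h3 | h3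
        · exact sin_pi_mul_div_mono hn (by positivity) h1 h3
        · rw [← hsymm]
          exact sin_pi_mul_div_mono hn (by positivity) (by linarith) (by linarith)
      linarith
  have hne : ∀ i j : Fin n, i < j → p i ≠ p j := by
    intro i j hij h
    have h1 := hdist i j hij
    have h2 := hpos i j hij
    rw [h, dist_self] at h1
    have : 0 < 2 * r * g ((j : ℕ) - (i : ℕ)) := by positivity
    linarith
  refine ⟨p, ?_, ?_⟩
  · intro i j h
    rcases lt_trichotomy i j with hij | hij | hij
    · exact absurd h (hne i j hij)
    · exact hij
    · exact absurd h.symm (hne j i hij)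
  · intro i j
    rcases lt_trichotomy i j with hij | rfl | hij
    · rw [hadj i j hij, and_iff_right hij.ne]
    · simp
    · rw [SimpleGraph.adj_comm, hadj j i hij, dist_comm, and_iff_right hij.ne']

/-- Three stable vertices would leave three cyclic gaps of at least `k`, needing `3k` vertices. -/
lemma indepNum_circularGraph {k : ℕ} (hk : 1 ≤ k) :
    (circularGraph (3 * k - 1) k).indepNum = 2 := by
  classical
  apply le_antisymm
  · obtain ⟨s, hs⟩ := (circularGraph (3 * k - 1) k).exists_isNIndepSet_indepNum
    rw [← hs.card_eq]
    by_contra hcon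
    obtain ⟨t, hts, ht⟩ := Finset.exists_subset_card_eq (show 3 ≤ s.card by omega)
    let e := t.orderEmbOfFin ht
    have hmem : ∀ i, e i ∈ (s : Set _) := fun i => hts (t.orderEmbOfFin_mem ht i)
    have hlt : ∀ i j, i < j → ¬ ((e j : ℕ) < e i + k ∨ 3 * k - 1 + e i < e j + k) :=
      fun i j hij => by
        rw [← circularGraph_adj_of_lt (e.strictMono hij)]
        exact hs.isIndepSet (hmem i) (hmem j) (e.strictMono hij).ne
    have h1 := hlt 0 1 (by decide)
    have h2 := hlt 1 2 (by decide)
    have h3 := hlt 0 2 (by decide)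
    omega
  · have hlt : (⟨0, by omega⟩ : Fin (3 * k - 1)) < ⟨k, by omega⟩ := by
      rw [Fin.mk_lt_mk]; omega
    have hind : (circularGraph (3 * k - 1) k).IsIndepSet
        (({⟨0, by omega⟩, ⟨k, by omega⟩} : Finset (Fin (3 * k - 1))) : Set _) := by
      rw [← SimpleGraph.isClique_compl, Finset.coe_pair, SimpleGraph.isClique_pair]
      intro h
      rw [SimpleGraph.compl_adj, circularGraph_adj_of_lt hlt]
      exact ⟨h, by dsimp only; omega⟩
    have := hind.card_le_indepNum
    rwa [Finset.card_pair hlt.ne] at this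

lemma cliqueNum_circularGraph {k : ℕ} (hk : 1 ≤ k) :
    (circularGraph (3 * k - 1) k).cliqueNum = k := by
  classical
  apply le_antisymm
  · obtain ⟨s, hs⟩ := (circularGraph (3 * k - 1) k).exists_isNClique_cliqueNum
    rw [← hs.card_eq]
    rcases s.eq_empty_or_nonempty with rfl | hne
    · simp
    have hadj : ∀ i ∈ s, ∀ j ∈ s, (i : ℕ) < j → (j : ℕ) < i + k ∨ 3 * k - 1 + i < j + k :=
      fun i hi j hj hij => (circularGraph_adj_of_lt hij).1 (hs.isClique hi hj (Fin.ne_of_lt hij))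
    set m := s.min' hne with hm
    have hms : m ∈ s := s.min'_mem hne
    have hmin : ∀ x ∈ s, (m : ℕ) ≤ x := fun x hx => s.min'_le x hx
    -- Folding by `2 * k - 1 = n - k`: vertices that differ by exactly this amount are nonadjacent,
    -- so `f` is injective on a clique.
    let f (x : Fin (3 * k - 1)) : ℕ :=
      if (x : ℕ) < m + k then x - m else x - m - (2 * k - 1)
    refine (Finset.card_le_card_of_injOn f (t := Finset.range k) ?_ ?_).trans
      (Finset.card_range k).le
    · intro x hx
      have h1 := hmin x hx
      have h2 := hadj m hms x hx
      have h3 := x.isLt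
      simp only [Finset.coe_range, Set.mem_Iio, f]
      split_ifs <;> omega
    · intro x hx y hy hxy
      have h1 := hmin x hx
      have h2 := hmin y hy
      have h3 := hadj m hms x hx
      have h4 := hadj m hms y hy
      have h5 := hadj x hx y hy
      have h6 := hadj y hy x hx
      have h7 := x.isLt
      have h8 := y.isLt
      simp only [f] at hxy
      ext
      split_ifs at hxy <;> omega
  · let s : Finset (Fin (3 * k - 1)) :=
      Finset.univ.image fun i : Fin k => ⟨i, by omega⟩
    have hadj : ∀ i j : Fin (3 * k - 1), (j : ℕ) < k → (i : ℕ) < j →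
        (circularGraph (3 * k - 1) k).Adj i j :=
      fun i j hj hij => (circularGraph_adj_of_lt hij).2 (by omega)
    have hs : ∀ i ∈ s, (i : ℕ) < k := by
      intro i hi
      obtain ⟨j, -, rfl⟩ := Finset.mem_image.1 hi
      exact j.isLt
    have hclique : (circularGraph (3 * k - 1) k).IsClique (s : Set _) := by
      intro i hi j hj hij
      rcases lt_or_gt_of_ne hij with h | h
      · exact hadj i j (hs j hj) h
      · exact (hadj j i (hs i hi) h).symm
    have hcard : s.card = k := by
      rw [Finset.card_image_of_injective, Finset.card_univ, Fintype.card_fin]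
      intro i j h
      simpa [Fin.ext_iff] using h
    exact hcard.symm.le.trans hclique.card_le_cliqueNum

lemma card_le_indepNum_mul_of_colorable {V : Type*} [Finite V] {G : SimpleGraph V} {m : ℕ}
    (h : G.Colorable m) : Nat.card V ≤ G.indepNum * m := by
  classical
  have := Fintype.ofFinite V
  obtain ⟨C⟩ := h
  rw [Nat.card_eq_fintype_card, ← Finset.card_univ]
  refine (Finset.card_le_mul_card_image_of_maps_to (f := C) (t := Finset.univ) (by simp)
    G.indepNum fun c _ => ?_).trans (by simp)
  refine SimpleGraph.IsIndepSet.card_le_indepNum fun u hu v hv _ huv => C.valid huv ?_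
  simp only [Finset.coe_filter, Finset.mem_univ, true_and, Set.mem_ofPred_eq] at hu hv
  rw [hu, hv]

lemma chromaticNumber_circularGraph {k : ℕ} (hk : 1 ≤ k) :
    ∃ m : ℕ, (circularGraph (3 * k - 1) k).chromaticNumber = (m : ℕ∞) ∧
      3 / 2 * (k : ℝ) - 1 / 2 ≤ (m : ℝ) := by
  have hcol := (circularGraph (3 * k - 1) k).colorable_of_fintype
  have h := card_le_indepNum_mul_of_colorable (SimpleGraph.colorable_chromaticNumber hcol)
  refine ⟨_, (ENat.natCast_toNat
    (hcol.chromaticNumber_le.trans_lt (ENat.natCast_lt_top _)).ne).symm, ?_⟩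
  rw [indepNum_circularGraph hk, Nat.card_eq_fintype_card, Fintype.card_fin] at h
  have h' : 3 * k ≤ 2 * (circularGraph (3 * k - 1) k).chromaticNumber.toNat + 1 := by omega
  have : (3 : ℝ) * k ≤ 2 * (circularGraph (3 * k - 1) k).chromaticNumber.toNat + 1 := by
    exact_mod_cast h'
  linarith

theorem theorem1 :
    (∀ (V : Type*) [Finite V] (G : SimpleGraph V),
      IsUnitDiskGraph G → G.indepNum ≤ 2 →
        ∃ m : ℕ, G.chromaticNumber = (m : ℕ∞) ∧ (m : ℝ) ≤ 3 / 2 * (G.cliqueNum : ℝ)) ∧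
    (∀ k : ℕ, 1 ≤ k →
      IsUnitDiskGraph (circularGraph (3 * k - 1) k) ∧
      (circularGraph (3 * k - 1) k).indepNum = 2 ∧
      (circularGraph (3 * k - 1) k).cliqueNum = k ∧
      ∃ m : ℕ, (circularGraph (3 * k - 1) k).chromaticNumber = (m : ℕ∞) ∧
        3 / 2 * (k : ℝ) - 1 / 2 ≤ (m : ℝ)) ∧
    (∀ c : ℝ, c < 3 / 2 → ∃ k : ℕ, 1 ≤ k ∧
      ∃ m : ℕ, (circularGraph (3 * k - 1) k).chromaticNumber = (m : ℕ∞) ∧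
        c * ((circularGraph (3 * k - 1) k).cliqueNum : ℝ) < (m : ℝ)) := by
  refine ⟨fun V _ G hG hα => hG.chromaticNumber_le hα, fun k hk =>
    ⟨isUnitDiskGraph_circularGraph hk (by omega), indepNum_circularGraph hk,
      cliqueNum_circularGraph hk, chromaticNumber_circularGraph hk⟩, fun c hc => ?_⟩
  -- This bound on `k` says exactly that `c * k < 3 / 2 * k - 1 / 2`.
  obtain ⟨k, hk⟩ := exists_nat_gt (1 / (2 * (3 / 2 - c)))
  have hc' : 0 < 2 * (3 / 2 - c) := by linarith
  have hk0 : 1 ≤ k := by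
    have : (0 : ℝ) < k := (one_div_pos.2 hc').trans hk
    exact_mod_cast this
  obtain ⟨m, hm, hle⟩ := chromaticNumber_circularGraph hk0
  refine ⟨k, hk0, m, hm, ?_⟩
  rw [cliqueNum_circularGraph hk0]
  rw [div_lt_iff₀ hc'] at hk
  linarith
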